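/- Let $\mathbb{F}_3=\{0,1,2\}$ be the field of order $3$ and let $H(n,3)$ be the Hamming graph on $\mathbb{F}_3^n$, in which two words are adjacent if they differ in exactly one position. A $1$-perfect code in $H(n,3)$ is an independent set $C$ of vertices such that every vertex outside $C$ is adjacent to exactly one element of $C$; a Hamming code is a $1$-perfect code that is a linear subspace; the rank of a code is the dimension of its affine span. A $t$-ary quasigroup of order $3$ is a function $f:\mathbb{F}_3^t\to\mathbb{F}_3$ whose graph $\{(x,f(x)) : x\in\mathbb{F}_3^t\}\subset\mathbb{F}_3^{t+1}$ consists of $3^t$ words, any two different of which differ in at least two positions. **Theorem.** Let $m\ge 1$, $n=(3^m-1)/2$ and $n'=(3^{m-1}-1)/2=(n-1)/3$. Let $C$ be a $1$-perfect code in $H(n,3)$ of rank at most $n-m+1$, and let $C^\star\subseteq\mathbb{F}_3^{n'}$ be a Hamming code of length $n'$ (for $m=1$, $n'=0$ and $C^\star$ consists of the empty word). Then there are an automorphism $\psi$ of the graph $H(n,3)$ and, for each $\mu=(\mu_0,\dots,\mu_{n'-1})\in C^\star$, an $n'$-ary quasigroup $\lambda_\mu$ of order $3$ such that $$\psi(C)=\bigcup_{\mu\in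 C^\star}K_\mu,$$ where $K_\mu$ is the set of all words $(x_0,x_1,\dots,x_{n-1})\in\mathbb{F}_3^n$ satisfying $$x_{3i+2}=\mu_i-x_{3i}-x_{3i+1}\quad\text{for } i=0,\dots,n'-1,$$ $$x_{n-1}=\lambda_\mu(x_1-x_0,\;x_4-x_3,\;\dots,\;x_{n-3}-x_{n-4}).$$ -/

import Mathlib

/-- Words of length `n` over the alphabet `{0, 1, 2}`, regarded as the field with three elements;
they form the vector space of dimension `n` over that field. -/
abbrev Word (n : ℕ) : Type := Fin n → ZMod 3

/-- The Hamming graph `H(n,3)`: two words are adjacent iff they differ in exactly one symbol. -/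
def hammingGraph3 (n : ℕ) : SimpleGraph (Word n) where
  Adj x y := hammingDist x y = 1
  symm := ⟨fun x y h => by rw [hammingDist_comm]; exact h⟩
  loopless := ⟨fun x h => by simp at h⟩

/-- A `1`-perfect code in a graph: an independent set of vertices such that every vertex outside of
it is adjacent to exactly one vertex of it. -/
def IsOnePerfect {V : Type*} (G : SimpleGraph V) (C : Set V) : Prop :=
  G.IsIndepSet C ∧ ∀ v, v ∉ C → ∃! c, c ∈ C ∧ G.Adj v c

/-- A Hamming code: a linear `1`-perfect code. -/
def IsHammingCode {n : ℕ} (C : Submodule (ZMod 3) (Word n)) : Prop :=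
  IsOnePerfect (hammingGraph3 n) (C : Set (Word n))

/-- The rank of a code: the dimension of its affine span. -/
noncomputable def codeRank {n : ℕ} (C : Set (Word n)) : ℕ :=
  Module.finrank (ZMod 3) (affineSpan (ZMod 3) C).direction

/-- `C` is an `(n, M, d)₃` code: it has `M` codewords, and no two different codewords are at
distance less than `d`. -/
def IsCodeWithParams (n M d : ℕ) (C : Set (Word n)) : Prop :=
  C.ncard = M ∧ ∀ x ∈ C, ∀ y ∈ C, x ≠ y → d ≤ hammingDist x y

/-- A `t`-ary quasigroup of order `3`: a function whose graph `{(x, f x)}` is a distance-`2` MDS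
code, that is, a `(t + 1, 3 ^ t, 2)₃` code. -/
def IsQuasigroup3 {t : ℕ} (f : Word t → ZMod 3) : Prop :=
  IsCodeWithParams (t + 1) (3 ^ t) 2
    (Set.range fun x : Word t => (Fin.snoc x (f x) : Word (t + 1)))

theorem length_eq_three_mul_add_one {m : ℕ} (hm : 1 ≤ m) :
    (3 ^ m - 1) / 2 = 3 * ((3 ^ (m - 1) - 1) / 2) + 1 := by
  obtain ⟨k, rfl⟩ : ∃ k, m = k + 1 := ⟨m - 1, by omega⟩
  have hodd : (3 ^ k) % 2 = 1 := by
    rw [Nat.pow_mod]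
    simp
  rw [Nat.add_sub_cancel, pow_succ]
  omega

/-- The position `3 i + j` in a word of length `n = 3 t + 1`. -/
def tripleCoord {n t : ℕ} (h : n = 3 * t + 1) (i : Fin t) (j : Fin 3) : Fin n :=
  ⟨3 * i.val + j.val, by omega⟩

/-- The last position, `n - 1 = 3 t`, in a word of length `n = 3 t + 1`. -/
def lastCoord {n t : ℕ} (h : n = 3 * t + 1) : Fin n :=
  ⟨3 * t, by omega⟩

/-- The `μ`-component given by the function `f`: the set of all words `(x_0, …, x_{n-1})` with
`x_{3i+2} = μ_i - x_{3i} - x_{3i+1}` for each `i`, and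
`x_{n-1} = f (x_1 - x_0, x_4 - x_3, …, x_{n-3} - x_{n-4})`. -/
def muComponent {n t : ℕ} (h : n = 3 * t + 1) (μ : Word t) (f : Word t → ZMod 3) :
    Set (Word n) :=
  {x | (∀ i : Fin t, x (tripleCoord h i 2) =
          μ i - x (tripleCoord h i 0) - x (tripleCoord h i 1)) ∧
        x (lastCoord h) = f fun i => x (tripleCoord h i 1) - x (tripleCoord h i 0)}

/-! The rank bound says that the direction `D` of the affine span of `C` has codimension at least `m
- 1`, the dimension of the syndrome space `Q` of the Hamming code. Hence some surjection `S` onto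
`Q` kills `D` and is constant on `C`. As `C` is perfect, every word is uniquely a codeword plus an
error of weight at most one, so counting words by syndrome gives equally many errors for each value
of `S`, namely `(2n+1)/(2n'+1) = 3`. So, up to scalars, `S` has one zero column and three copies of
each column of the Hamming check matrix (`exists_columns_eq_smul`). A translation and a monomial map
turn `S` into "syndrome of the block sums" (`exists_iso_blockSum_mem`).

Once all block sums lie in the Hamming code, perfectness makes the code invariant under adding a
constant to a triple (`add_liftWord_mem`). Modulo these periods a word is given by its block sums
`μ`, its differences `d` and its last symbol. Perfectness determines the last symbol from `μ` and
`d`, and this defines `λ_μ`. -/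

theorem hammingDist_add_single_le_one {n : ℕ} (x : Word n) (k : Fin n) (a : ZMod 3) :
    hammingDist x (x + Pi.single k a) ≤ 1 := by
  unfold hammingDist
  refine Finset.card_le_one.2 fun i hi j hj => ?_
  have key : ∀ l, l ∈ Finset.univ.filter (fun l => x l ≠ (x + Pi.single k a : Word n) l) →
      l = k := by
    intro l hl
    by_contra h
    simp [h] at hl
  rw [key i hi, key j hj]

theorem eq_or_exists_eq_add_single {n : ℕ} {x y : Word n} (h : hammingDist x y ≤ 1) :
    y = x ∨ ∃ (k : Fin n) (a : ZMod 3), y = x + Pi.single k a := by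
  by_cases hxy : y = x
  · exact Or.inl hxy
  right
  obtain ⟨k, hk⟩ := Function.ne_iff.1 hxy
  refine ⟨k, y k - x k, ?_⟩
  funext l
  by_cases hl : l = k
  · subst hl
    simp
  · have : x l = y l := by
      by_contra hne
      exact hl (Finset.card_le_one.1 h l (by simpa using hne) k (by simpa using Ne.symm hk))
    simp [hl, this]

/-! ### Perfect codes as tilings by balls of radius one. -/

namespace IsOnePerfect

variable {n : ℕ} {C : Set (Word n)}

theorem existsUnique_hammingDist_le_one (hC : IsOnePerfect (hammingGraph3 n) C) (v : Word n) :
    ∃! c, c ∈ C ∧ hammingDist v c ≤ 1 := by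
  by_cases hv : v ∈ C
  · refine ⟨v, ⟨hv, by simp⟩, fun c hc => ?_⟩
    by_contra hne
    have hpos : 0 < hammingDist v c := hammingDist_pos.2 (Ne.symm hne)
    exact hC.1 hv hc.1 (Ne.symm hne) (show hammingDist v c = 1 by omega)
  · obtain ⟨c, ⟨hcC, hc⟩, huniq⟩ := hC.2 v hv
    refine ⟨c, ⟨hcC, le_of_eq hc⟩, fun d hd => huniq d ⟨hd.1, ?_⟩⟩
    have hne : v ≠ d := fun h => hv (h ▸ hd.1)
    have hpos : 0 < hammingDist v d := hammingDist_pos.2 hne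
    have := hd.2
    show hammingDist v d = 1
    omega

theorem eq_of_hammingDist_le_one (hC : IsOnePerfect (hammingGraph3 n) C) {v c d : Word n}
    (hc : c ∈ C) (hd : d ∈ C) (hvc : hammingDist v c ≤ 1) (hvd : hammingDist v d ≤ 1) : c = d :=
  (hC.existsUnique_hammingDist_le_one v).unique ⟨hc, hvc⟩ ⟨hd, hvd⟩

/-- Two codewords that agree outside of two positions are equal. -/
theorem eq_of_add_single_add_single (hC : IsOnePerfect (hammingGraph3 n) C) {c d : Word n}
    {k l : Fin n} {a b : ZMod 3} (hc : c ∈ C) (hd : d ∈ C)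
    (h : d = c + Pi.single k a + Pi.single l b) : c = d := by
  refine hC.eq_of_hammingDist_le_one (v := c + Pi.single k a) hc hd ?_ ?_
  · rw [hammingDist_comm]
    exact hammingDist_add_single_le_one _ _ _
  · rw [h]
    exact hammingDist_add_single_le_one _ _ _

theorem exists_mem_of_add_single (hC : IsOnePerfect (hammingGraph3 n) C) (v : Word n) :
    v ∈ C ∨ ∃ (k : Fin n) (a : ZMod 3), v + Pi.single k a ∈ C := by
  obtain ⟨c, ⟨hc, hd⟩, -⟩ := hC.existsUnique_hammingDist_le_one v
  obtain rfl | ⟨k, a, rfl⟩ := eq_or_exists_eq_add_single hd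
  · exact Or.inl hc
  · exact Or.inr ⟨k, a, hc⟩

theorem nonempty (hC : IsOnePerfect (hammingGraph3 n) C) : C.Nonempty := by
  obtain ⟨c, ⟨hc, -⟩, -⟩ := hC.existsUnique_hammingDist_le_one 0
  exact ⟨c, hc⟩

theorem image {V W : Type*} {G : SimpleGraph V} {H : SimpleGraph W} {C : Set V}
    (hC : IsOnePerfect G C) (e : G ≃g H) : IsOnePerfect H (e '' C) := by
  refine ⟨?_, fun v hv => ?_⟩
  · rintro _ ⟨x, hx, rfl⟩ _ ⟨y, hy, rfl⟩ hne
    rw [e.map_adj_iff]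
    exact hC.1 hx hy fun h => hne (h ▸ rfl)
  · obtain ⟨w, rfl⟩ := e.surjective v
    obtain ⟨c, ⟨hc, hadj⟩, huniq⟩ := hC.2 w fun h => hv ⟨w, h, rfl⟩
    refine ⟨e c, ⟨⟨c, hc, rfl⟩, e.map_adj_iff.2 hadj⟩, ?_⟩
    rintro _ ⟨⟨d, hd, rfl⟩, hd'⟩
    rw [huniq d ⟨hd, e.map_adj_iff.1 hd'⟩]

end IsOnePerfect

theorem IsHammingCode.eq_zero_of_single_add_single {n : ℕ} {H : Submodule (ZMod 3) (Word n)}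
    (hH : IsHammingCode H) {i j : Fin n} {a b : ZMod 3}
    (h : (Pi.single i a + Pi.single j b : Word n) ∈ H) :
    (Pi.single i a + Pi.single j b : Word n) = 0 :=
  (IsOnePerfect.eq_of_add_single_add_single hH (SetLike.mem_coe.2 H.zero_mem)
    (SetLike.mem_coe.2 h) (by rw [zero_add])).symm

theorem IsHammingCode.eq_zero_of_single {n : ℕ} {H : Submodule (ZMod 3) (Word n)}
    (hH : IsHammingCode H) {i : Fin n} {a : ZMod 3} (h : (Pi.single i a : Word n) ∈ H) :
    a = 0 := by
  have := hH.eq_zero_of_single_add_single (i := i) (j := i) (a := a) (b := 0) (by simpa using h)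
  simpa using this

/-! ### Coordinates in triples, block sums and normal forms. -/

section Blocks

variable {n t : ℕ} (h : n = 3 * t + 1)

/-- The enumeration of the positions by the `t` triples and the last position. -/
def blockCoord : Option (Fin t × Fin 3) → Fin n
  | none => lastCoord h
  | some p => tripleCoord h p.1 p.2

theorem blockCoord_injective : Function.Injective (blockCoord h) := by
  rintro (_ | ⟨i, j⟩) (_ | ⟨i', j'⟩) hij <;>
    simp only [blockCoord, tripleCoord, lastCoord, Fin.mk.injEq] at hij
  · rfl
  · omega
  · omega
  · have h1 : i = i' := Fin.ext (by omega)
    have h2 : j = j' := Fin.ext (by omega)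
    rw [h1, h2]

theorem bijective_of_injective_option {f : Option (Fin t × Fin 3) → Fin n} (h : n = 3 * t + 1)
    (hf : Function.Injective f) : Function.Bijective f := by
  rw [Fintype.bijective_iff_injective_and_card]
  refine ⟨hf, ?_⟩
  simp [h, mul_comm]

/-- `blockCoord` as an equivalence. -/
noncomputable def blockEquiv : Option (Fin t × Fin 3) ≃ Fin n :=
  Equiv.ofBijective (blockCoord h) (bijective_of_injective_option h (blockCoord_injective h))

@[simp]
theorem blockEquiv_none : blockEquiv h none = lastCoord h := rfl

@[simp]
theorem blockEquiv_some (i : Fin t) (j : Fin 3) :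
    blockEquiv h (some (i, j)) = tripleCoord h i j := rfl

@[simp]
theorem blockEquiv_symm_last : (blockEquiv h).symm (lastCoord h) = none := by
  rw [Equiv.symm_apply_eq, blockEquiv_none]

@[simp]
theorem blockEquiv_symm_triple (i : Fin t) (j : Fin 3) :
    (blockEquiv h).symm (tripleCoord h i j) = some (i, j) := by
  rw [Equiv.symm_apply_eq, blockEquiv_some]

theorem coord_cases (k : Fin n) : k = lastCoord h ∨ ∃ i j, k = tripleCoord h i j := by
  obtain ⟨o, rfl⟩ := (blockEquiv h).surjective k
  rcases o with _ | ⟨i, j⟩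
  · exact Or.inl rfl
  · exact Or.inr ⟨i, j, rfl⟩

@[simp]
theorem tripleCoord_inj {i i' : Fin t} {j j' : Fin 3} :
    tripleCoord h i j = tripleCoord h i' j' ↔ i = i' ∧ j = j' := by
  rw [← blockEquiv_some, ← blockEquiv_some, (blockEquiv h).injective.eq_iff]
  simp

@[simp]
theorem tripleCoord_ne_lastCoord {i : Fin t} {j : Fin 3} :
    tripleCoord h i j ≠ lastCoord h := by
  rw [← blockEquiv_some, ← blockEquiv_none, (blockEquiv h).injective.ne_iff]
  simp

@[simp]
theorem lastCoord_ne_tripleCoord {i : Fin t} {j : Fin 3} :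
    lastCoord h ≠ tripleCoord h i j :=
  (tripleCoord_ne_lastCoord h).symm

theorem word_ext {x y : Word n} (hlast : x (lastCoord h) = y (lastCoord h))
    (htriple : ∀ i j, x (tripleCoord h i j) = y (tripleCoord h i j)) : x = y := by
  funext k
  obtain rfl | ⟨i, j, rfl⟩ := coord_cases h k
  · exact hlast
  · exact htriple i j

/-- The word with entries `f i j` at the triples and `y` at the last position. -/
noncomputable def ofBlocks (f : Fin t → Fin 3 → ZMod 3) (y : ZMod 3) : Word n :=
  fun k => ((blockEquiv h).symm k).elim y fun p => f p.1 p.2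

@[simp]
theorem ofBlocks_last (f : Fin t → Fin 3 → ZMod 3) (y : ZMod 3) :
    ofBlocks h f y (lastCoord h) = y := by
  simp [ofBlocks]

@[simp]
theorem ofBlocks_triple (f : Fin t → Fin 3 → ZMod 3) (y : ZMod 3) (i : Fin t) (j : Fin 3) :
    ofBlocks h f y (tripleCoord h i j) = f i j := by
  simp [ofBlocks]

/-- The sums of the symbols of a word over the triples of positions. -/
def blockSum (x : Word n) : Word t :=
  fun i => ∑ j, x (tripleCoord h i j)

theorem blockSum_add (x y : Word n) : blockSum h (x + y) = blockSum h x + blockSum h y := by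
  funext i
  simp [blockSum, Finset.sum_add_distrib]

@[simp]
theorem blockSum_single_last (a : ZMod 3) :
    blockSum h (Pi.single (lastCoord h) a) = 0 := by
  funext i
  simp [blockSum]

@[simp]
theorem blockSum_single_triple (i : Fin t) (j : Fin 3) (a : ZMod 3) :
    blockSum h (Pi.single (tripleCoord h i j) a) = Pi.single i a := by
  funext i'
  by_cases hi : i' = i
  · subst hi
    simp [blockSum, Pi.single_apply]
  · simp [blockSum, hi]

/-- The word that is constant `w i` on the `i`-th triple and `0` at the last position. -/
noncomputable def liftWord (w : Word t) : Word n := ofBlocks h (fun i _ => w i) 0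

theorem liftWord_add (w w' : Word t) : liftWord h (w + w') = liftWord h w + liftWord h w' := by
  apply word_ext h <;> simp [liftWord]

theorem liftWord_zero : liftWord h (0 : Word t) = 0 := by
  apply word_ext h <;> simp [liftWord]

/-- The word with zero first entries in the triples, block sums `μ`, differences `d`, and last
symbol `y`. -/
noncomputable def baseWord (μ d : Word t) (y : ZMod 3) : Word n :=
  ofBlocks h (fun i => ![0, d i, μ i - d i]) y

theorem blockSum_baseWord (μ d : Word t) (y : ZMod 3) : blockSum h (baseWord h μ d y) = μ := by
  funext i
  simp [blockSum, baseWord, Fin.sum_univ_three]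

theorem baseWord_add_single_last (μ d : Word t) (y a : ZMod 3) :
    baseWord h μ d y + Pi.single (lastCoord h) a = baseWord h μ d (y + a) := by
  apply word_ext h <;> simp [baseWord]

theorem baseWord_add_single (μ d : Word t) (y : ZMod 3) (i : Fin t) (a : ZMod 3) :
    baseWord h μ (d + Pi.single i a) y =
      baseWord h μ d y + Pi.single (tripleCoord h i 1) a + Pi.single (tripleCoord h i 2) (-a) := by
  apply word_ext h
  · simp [baseWord]
  · intro i' j
    by_cases hi : i' = i
    · subst hi
      fin_cases j <;> simp [baseWord, Pi.single_apply]
      ring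
    · simp [baseWord, Pi.single_apply, hi]

theorem eq_baseWord_add_liftWord {μ : Word t} {x : Word n}
    (hx : ∀ i, x (tripleCoord h i 2) = μ i - x (tripleCoord h i 0) - x (tripleCoord h i 1)) :
    x = baseWord h μ (fun i => x (tripleCoord h i 1) - x (tripleCoord h i 0)) (x (lastCoord h)) +
      liftWord h fun i => x (tripleCoord h i 0) := by
  apply word_ext h
  · simp [baseWord, liftWord]
  · intro i j
    fin_cases j <;> simp [baseWord, liftWord, hx]
    generalize x (tripleCoord h i 0) = a
    generalize x (tripleCoord h i 1) = b
    generalize μ i = c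
    -- Subtracting `a` from the third symbol `c - a - b` gives `c - (b - a)` only in characteristic
    -- 3.
    have h3 : (3 : ZMod 3) = 0 := rfl
    linear_combination (-a) * h3

end Blocks

/-! ### Codes whose block sums lie in a Hamming code. -/

section Components

variable {n t : ℕ} (h : n = 3 * t + 1) {C : Set (Word n)} {H : Submodule (ZMod 3) (Word t)}

/-- Add 1 at two positions of the triple and correct the result to a codeword. The block sums
restrict the correction to adding 1 within the same triple, and at either of the two positions
already used it would give a codeword at distance 2 from `x`. So it is at the third. -/
theorem add_liftWord_single_one_mem (hC : IsOnePerfect (hammingGraph3 n) C) (hH : IsHammingCode H)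
    (hCH : ∀ x ∈ C, blockSum h x ∈ H) {x : Word n} (hx : x ∈ C) (i : Fin t) :
    x + liftWord h (Pi.single i 1) ∈ C := by
  set e : Fin 3 → Word n := fun j => Pi.single (tripleCoord h i j) 1 with he
  have h2 : (1 + 1 : ZMod 3) ≠ 0 := by decide
  have hsum : ∀ w : Word n, x + e 0 + e 1 + w ∈ C →
      (Pi.single i (1 + 1) + blockSum h w : Word t) ∈ H := by
    intro w hw
    have := H.sub_mem (hCH _ hw) (hCH x hx)
    simp only [he, blockSum_add, blockSum_single_triple] at this
    convert this using 1
    rw [Pi.single_add]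
    abel
  rcases hC.exists_mem_of_add_single (x + e 0 + e 1) with hz | ⟨k, a, hz⟩
  · refine absurd (hH.eq_zero_of_single (i := i) (a := 1 + 1) ?_) h2
    have := hsum (Pi.single (lastCoord h) 0) (by simpa using hz)
    rwa [blockSum_single_last, add_zero] at this
  obtain rfl | ⟨i', j, rfl⟩ := coord_cases h k
  · exact absurd (hH.eq_zero_of_single (by simpa using hsum _ hz)) h2
  have hmem := hsum _ hz
  rw [blockSum_single_triple] at hmem
  by_cases hi : i' = i
  · subst hi
    rw [← Pi.single_add] at hmem
    have ha : a = 1 := by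
      have h3 : (3 : ZMod 3) = 0 := rfl
      linear_combination hH.eq_zero_of_single hmem - h3
    subst ha
    have hne : ∀ (j₀ j₁ : Fin 3), j₀ ≠ j₁ →
        x + Pi.single (tripleCoord h i' j₀) (1 + 1) + Pi.single (tripleCoord h i' j₁) 1 ∉ C := by
      intro j₀ j₁ hj hmem
      have := congrFun (hC.eq_of_add_single_add_single hx hmem rfl) (tripleCoord h i' j₁)
      simp [hj.symm] at this
    fin_cases j
    · refine absurd hz ?_
      convert hne 0 1 (by decide) using 2
      rw [Pi.single_add]
      simp only [he, Fin.zero_eta]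
      abel
    · refine absurd hz ?_
      convert hne 1 0 (by decide) using 2
      rw [Pi.single_add]
      simp only [he, Fin.mk_one]
      abel
    · convert hz using 1
      apply word_ext h
      · simp [he, liftWord]
      · intro i₀ j₀
        by_cases hi₀ : i₀ = i'
        · subst hi₀
          fin_cases j₀ <;> simp [he, liftWord, Pi.single_apply]
        · simp [he, liftWord, Pi.single_apply, hi₀]
  · have := congrFun (hH.eq_zero_of_single_add_single hmem) i
    rw [Pi.add_apply, Pi.single_eq_same, Pi.single_eq_of_ne (Ne.symm hi), add_zero] at this
    exact absurd this h2

theorem add_liftWord_mem (hC : IsOnePerfect (hammingGraph3 n) C) (hH : IsHammingCode H)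
    (hCH : ∀ x ∈ C, blockSum h x ∈ H) {x : Word n} (hx : x ∈ C) (w : Word t) :
    x + liftWord h w ∈ C := by
  -- The periods of this kind form a monoid, so the generators suffice.
  let S : AddSubmonoid (Word t) :=
    { carrier := {w | ∀ x ∈ C, x + liftWord h w ∈ C}
      zero_mem' := fun x hx => by rwa [liftWord_zero, add_zero]
      add_mem' := fun {a b} ha hb x hx => by
        rw [liftWord_add, ← add_assoc]
        exact hb _ (ha x hx) }
  suffices hw : w ∈ S from hw x hx
  rw [← Finset.univ_sum_single w]
  refine S.sum_mem fun i _ => ?_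
  have hi : (Pi.single i 1 : Word t) ∈ S :=
    fun x hx => add_liftWord_single_one_mem h hC hH hCH hx i
  have : (Pi.single i (w i) : Word t) = (w i).val • Pi.single i 1 := by
    rw [← Pi.single_smul, nsmul_one, ZMod.natCast_zmod_val]
  rw [this]
  exact S.nsmul_mem hi _

/-- Correcting a symbol inside a triple would move the block sums from `μ` by a word of weight one,
hence out of `H`. Only the last symbol can need correction. -/
theorem existsUnique_baseWord_mem (hC : IsOnePerfect (hammingGraph3 n) C) (hH : IsHammingCode H)
    (hCH : ∀ x ∈ C, blockSum h x ∈ H) {μ : Word t} (hμ : μ ∈ H) (d : Word t) :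
    ∃! y, baseWord h μ d y ∈ C := by
  have hex : ∃ y, baseWord h μ d y ∈ C := by
    rcases hC.exists_mem_of_add_single (baseWord h μ d 0) with hz | ⟨k, a, hz⟩
    · exact ⟨0, hz⟩
    obtain rfl | ⟨i, j, rfl⟩ := coord_cases h k
    · rw [baseWord_add_single_last] at hz
      exact ⟨_, hz⟩
    · have := hCH _ hz
      rw [blockSum_add, blockSum_baseWord, blockSum_single_triple, H.add_mem_iff_right hμ] at this
      rw [hH.eq_zero_of_single this, Pi.single_zero, add_zero] at hz
      exact ⟨0, hz⟩
  obtain ⟨y, hy⟩ := hex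
  refine ⟨y, hy, fun y' hy' => ?_⟩
  have := hC.eq_of_add_single_add_single (k := lastCoord h) (l := lastCoord h) (a := y' - y)
    (b := 0) hy hy' (by simp [baseWord_add_single_last])
  simpa [baseWord] using (congrFun this (lastCoord h)).symm

/-- Distinct points of a graph at distance one must differ in a single argument, with equal values.
-/
theorem isQuasigroup3_of_eq_zero {f : Word t → ZMod 3}
    (hf : ∀ d i a, f (d + Pi.single i a) = f d → a = 0) : IsQuasigroup3 f := by
  have hinj : Function.Injective fun x : Word t => (Fin.snoc x (f x) : Word (t + 1)) := by
    intro x y hxy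
    have := congrArg (Fin.init (α := fun _ => ZMod 3)) hxy
    simpa only [Fin.init_snoc] using this
  refine ⟨?_, ?_⟩
  · rw [← Set.image_univ, Set.ncard_image_of_injective _ hinj, Set.ncard_univ]
    simp
  · rintro _ ⟨x, rfl⟩ _ ⟨y, rfl⟩ hne
    by_contra hlt
    apply hne
    rcases eq_or_exists_eq_add_single (Nat.lt_succ_iff.1 (not_le.1 hlt)) with he | ⟨k, a, he⟩
    · exact he.symm
    have hcast : ∀ i : Fin t, y i = x i + (Pi.single k a : Word (t + 1)) i.castSucc := by
      intro i
      simpa using congrFun he i.castSucc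
    have hlast : f y = f x + (Pi.single k a : Word (t + 1)) (Fin.last t) := by
      simpa using congrFun he (Fin.last t)
    suffices y = x by rw [this]
    induction k using Fin.lastCases with
    | last =>
      funext i
      simpa using hcast i
    | cast i =>
      have hy : y = x + Pi.single i a := by
        funext i'
        rw [hcast i', Pi.add_apply]
        simp [Pi.single_apply]
      rw [hy] at hlast ⊢
      have ha : a = 0 := hf x i a (by simpa using hlast)
      simp [ha]

/-- A perfect code all of whose block sums lie in a Hamming code is a union of components. -/
theorem exists_eq_iUnion_muComponent (hC : IsOnePerfect (hammingGraph3 n) C)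
    (hH : IsHammingCode H) (hCH : ∀ x ∈ C, blockSum h x ∈ H) :
    ∃ lam : H → Word t → ZMod 3,
      (∀ μ, IsQuasigroup3 (lam μ)) ∧ C = ⋃ μ : H, muComponent h μ.1 (lam μ) := by
  choose lam hlam huniq using fun (μ : H) (d : Word t) =>
    existsUnique_baseWord_mem h hC hH hCH μ.2 d
  refine ⟨lam, fun μ => isQuasigroup3_of_eq_zero fun d i a hda => ?_, ?_⟩
  · have hmem := hlam μ (d + Pi.single i a)
    rw [hda, baseWord_add_single] at hmem
    have := congrFun (hC.eq_of_add_single_add_single (hlam μ d) hmem rfl) (tripleCoord h i 1)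
    simpa [Pi.single_apply] using this
  ext x
  simp only [Set.mem_iUnion]
  constructor
  · intro hx
    have hsum : ∀ i, x (tripleCoord h i 2) =
        blockSum h x i - x (tripleCoord h i 0) - x (tripleCoord h i 1) := by
      intro i
      simp only [blockSum, Fin.sum_univ_three]
      ring
    refine ⟨⟨blockSum h x, hCH x hx⟩, hsum, huniq _ _ _ ?_⟩
    -- Periods clear the first symbol of every triple, bringing `x` to its normal form.
    have := add_liftWord_mem h hC hH hCH hx (-fun i => x (tripleCoord h i 0))
    nth_rewrite 1 [eq_baseWord_add_liftWord h hsum] at this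
    rwa [add_assoc, ← liftWord_add, add_neg_cancel, liftWord_zero, add_zero] at this
  · rintro ⟨μ, hsum, hlast⟩
    rw [eq_baseWord_add_liftWord h hsum, hlast]
    exact add_liftWord_mem h hC hH hCH (hlam μ _) _

end Components

/-! ### Counting single errors by syndrome. -/

section Syndromes

variable {n : ℕ} {Q : Type*} [AddCommGroup Q] [Module (ZMod 3) Q]

/-- The multiples by nonzero scalars of the vectors `h k`, together with the zero vector. -/
def scaledColumn (h : Fin n → Q) (p : Option (Fin n × (ZMod 3)ˣ)) : Q :=
  p.elim 0 fun q => (q.2 : ZMod 3) • h q.1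

@[simp]
theorem scaledColumn_none (h : Fin n → Q) : scaledColumn h none = 0 := rfl

@[simp]
theorem scaledColumn_some (h : Fin n → Q) (k : Fin n) (a : (ZMod 3)ˣ) :
    scaledColumn h (some (k, a)) = (a : ZMod 3) • h k := rfl

theorem map_scaledColumn {R : Type*} [AddCommGroup R] [Module (ZMod 3) R] (S : Q →ₗ[ZMod 3] R)
    (h : Fin n → Q) (p : Option (Fin n × (ZMod 3)ˣ)) :
    S (scaledColumn h p) = scaledColumn (fun k => S (h k)) p := by
  rcases p with _ | ⟨k, a⟩ <;> simp

/-- The word with the single nonzero symbol described by `p`. -/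
abbrev errorWord (p : Option (Fin n × (ZMod 3)ˣ)) : Word n :=
  scaledColumn (fun k => (Pi.single k 1 : Word n)) p

theorem errorWord_some (k : Fin n) (a : (ZMod 3)ˣ) :
    errorWord (some (k, a)) = Pi.single k (a : ZMod 3) := by
  rw [errorWord, scaledColumn_some, ← Pi.single_smul, smul_eq_mul, mul_one]

theorem hammingDist_add_errorWord_le_one (x : Word n) (p : Option (Fin n × (ZMod 3)ˣ)) :
    hammingDist (x + errorWord p) x ≤ 1 := by
  rw [hammingDist_comm]
  rcases p with _ | ⟨k, a⟩
  · simp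
  · rw [errorWord_some]
    exact hammingDist_add_single_le_one _ _ _

theorem errorWord_injective : Function.Injective (errorWord (n := n)) := by
  rintro (_ | ⟨k, a⟩) (_ | ⟨l, b⟩) h
  · rfl
  · rw [errorWord_some] at h
    exact absurd (Pi.single_eq_zero_iff.1 h.symm) b.ne_zero
  · rw [errorWord_some] at h
    exact absurd (Pi.single_eq_zero_iff.1 h) a.ne_zero
  · rw [errorWord_some, errorWord_some] at h
    have hk := congrFun h k
    by_cases hkl : k = l
    · subst hkl
      rw [Pi.single_eq_same, Pi.single_eq_same] at hk
      rw [Units.ext hk]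
    · rw [Pi.single_eq_same, Pi.single_eq_of_ne hkl] at hk
      exact absurd hk a.ne_zero

theorem exists_add_errorWord_eq {C : Set (Word n)} (hC : IsOnePerfect (hammingGraph3 n) C)
    (x : Word n) : ∃ c ∈ C, ∃ p, c + errorWord p = x := by
  rcases hC.exists_mem_of_add_single x with hx | ⟨k, a, hx⟩
  · exact ⟨x, hx, none, by simp⟩
  · by_cases ha : a = 0
    · exact ⟨_, hx, none, by simp [ha]⟩
    · refine ⟨_, hx, some (k, Units.mk0 (-a) (neg_ne_zero.2 ha)), ?_⟩
      rw [errorWord_some, Units.val_mk0, Pi.single_neg, add_neg_cancel_right]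

theorem card_fiber_mul_card [Finite Q] {S : Word n →ₗ[ZMod 3] Q} (hS : Function.Surjective S)
    (s : Q) : Nat.card {x // S x = s} * Nat.card Q = 3 ^ n := by
  obtain ⟨x₀, rfl⟩ := hS s
  have e : {x // S x = S x₀} ≃ LinearMap.ker S :=
    { toFun := fun x => ⟨x.1 - x₀, by simp [x.2]⟩
      invFun := fun x => ⟨x.1 + x₀, by simp [LinearMap.mem_ker.1 x.2]⟩
      left_inv := fun x => by simp
      right_inv := fun x => by simp }
  rw [Nat.card_congr e, ← Nat.card_congr (S.quotKerEquivOfSurjective hS).toEquiv,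
    ← Submodule.card_eq_card_quotient_mul_card]
  simp

/-- A perfect code multiplied by the errors with a given syndrome fills the words with a given
syndrome. -/
theorem IsOnePerfect.card_mul_card_fiber_mul_card [Finite Q] {C : Set (Word n)}
    (hC : IsOnePerfect (hammingGraph3 n) C) {S : Word n →ₗ[ZMod 3] Q} (hS : Function.Surjective S)
    {s₀ : Q} (hSC : ∀ c ∈ C, S c = s₀) (s : Q) :
    Nat.card C * Nat.card {p // S (errorWord p) = s} * Nat.card Q = 3 ^ n := by
  rw [← card_fiber_mul_card hS (s₀ + s), ← Nat.card_prod]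
  congr 1
  refine Nat.card_congr (Equiv.ofBijective
    (fun q => ⟨q.1.1 + errorWord q.2.1, by rw [map_add, hSC _ q.1.2, q.2.2]⟩) ⟨?_, ?_⟩)
  · rintro ⟨⟨c, hc⟩, p, hp⟩ ⟨⟨d, hd⟩, r, hr⟩ heq
    have heq' : c + errorWord p = d + errorWord r := congrArg Subtype.val heq
    obtain rfl : c = d := hC.eq_of_hammingDist_le_one (v := c + errorWord p) hc hd
      (hammingDist_add_errorWord_le_one _ _)
      (heq' ▸ hammingDist_add_errorWord_le_one _ _)
    obtain rfl : p = r := errorWord_injective (add_left_cancel heq')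
    rfl
  · rintro ⟨x, hx⟩
    obtain ⟨c, hc, p, rfl⟩ := exists_add_errorWord_eq hC x
    refine ⟨⟨⟨c, hc⟩, p, ?_⟩, rfl⟩
    rwa [map_add, hSC c hc, add_right_inj] at hx

theorem card_option_prod_units : Nat.card (Option (Fin n × (ZMod 3)ˣ)) = 2 * n + 1 := by
  have : Fintype.card (ZMod 3)ˣ = 2 := ZMod.card_units 3
  simp [this, mul_comm]

/-- Compare the count for `S` with the count for the zero map, where all `2n + 1` errors share one
syndrome, and cancel the size of `C`. -/
theorem IsOnePerfect.card_fiber_mul_card [Finite Q] {C : Set (Word n)}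
    (hC : IsOnePerfect (hammingGraph3 n) C) {S : Word n →ₗ[ZMod 3] Q} (hS : Function.Surjective S)
    {s₀ : Q} (hSC : ∀ c ∈ C, S c = s₀) (s : Q) :
    Nat.card {p // scaledColumn (fun k => S (Pi.single k 1)) p = s} * Nat.card Q = 2 * n + 1 := by
  have h₁ := hC.card_mul_card_fiber_mul_card hS hSC s
  have h₂ := hC.card_mul_card_fiber_mul_card (Q := PUnit) (S := 0)
    (fun q => ⟨0, Subsingleton.elim _ _⟩) (s₀ := 0) (fun _ _ => rfl) 0
  have h₃ : Nat.card {p : Option (Fin n × (ZMod 3)ˣ) //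
      (0 : Word n →ₗ[ZMod 3] PUnit) (errorWord p) = 0} = 2 * n + 1 := by
    rw [← card_option_prod_units]
    exact Nat.card_congr (Equiv.subtypeUnivEquiv fun _ => rfl)
  rw [h₃, Nat.card_unique (α := PUnit), mul_one, ← h₁, mul_assoc] at h₂
  have hpos : 0 < Nat.card C := by
    have := hC.nonempty.to_subtype
    exact Nat.card_pos
  simp only [← map_scaledColumn]
  exact (Nat.eq_of_mul_eq_mul_left hpos h₂).symm

theorem IsHammingCode.scaledColumn_mkQ_injective {H : Submodule (ZMod 3) (Word n)}
    (hH : IsHammingCode H) :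
    Function.Injective (scaledColumn fun k => H.mkQ (Pi.single k 1 : Word n)) := by
  intro p r hpr
  rw [← map_scaledColumn, ← map_scaledColumn] at hpr
  change H.mkQ (errorWord p) = H.mkQ (errorWord r) at hpr
  have hmem : errorWord p - errorWord r ∈ H := by
    rwa [← Submodule.ker_mkQ H, LinearMap.mem_ker, map_sub, sub_eq_zero]
  apply errorWord_injective
  rw [← sub_eq_zero]
  refine (IsOnePerfect.eq_of_hammingDist_le_one hH (v := errorWord p) hmem H.zero_mem ?_ ?_)
  · have := hammingDist_add_errorWord_le_one (errorWord p - errorWord r) r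
    rwa [sub_add_cancel] at this
  · simpa using hammingDist_add_errorWord_le_one 0 p

/-- Distinct single errors have distinct syndromes, so each fibre in the count has size one. -/
theorem IsHammingCode.card_quotient {H : Submodule (ZMod 3) (Word n)} (hH : IsHammingCode H) :
    Nat.card (Word n ⧸ H) = 2 * n + 1 := by
  have key := IsOnePerfect.card_fiber_mul_card hH H.mkQ_surjective (s₀ := 0)
    (fun c hc => (Submodule.Quotient.mk_eq_zero H).2 hc) 0
  have hinj := hH.scaledColumn_mkQ_injective
  have : Nat.card {p // scaledColumn (fun k => H.mkQ (Pi.single k 1 : Word n)) p = 0} = 1 := by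
    rw [Nat.card_eq_one_iff_unique]
    exact ⟨⟨fun p r => Subtype.ext (hinj (p.2.trans r.2.symm))⟩, ⟨none, rfl⟩⟩
  rwa [this, one_mul] at key

/-- If each vector is a scaled column of `h` in exactly three ways, and the scaled columns of `h'`
are different, then up to scaling the columns of `h` include three copies of each column of `h'`
and a zero column. -/
theorem exists_columns_eq_smul {t : ℕ} {h : Fin n → Q} {h' : Fin t → Q}
    (hcard : ∀ s, Nat.card {p // scaledColumn h p = s} = 3)
    (hinj : Function.Injective (scaledColumn h')) :
    ∃ (g : Option (Fin t × Fin 3) → Fin n) (a : Option (Fin t × Fin 3) → (ZMod 3)ˣ),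
      Function.Injective g ∧ h (g none) = 0 ∧
        ∀ i j, (a (some (i, j)) : ZMod 3) • h (g (some (i, j))) = h' i := by
  have h'_ne : ∀ i, h' i ≠ 0 := by
    intro i hi
    have : some (i, (1 : (ZMod 3)ˣ)) = none :=
      hinj (by rw [scaledColumn_some, hi, smul_zero, scaledColumn_none])
    cases this
  have hzero : ∃ z, h z = 0 := by
    -- The empty error is only one of the three representations of 0; any other exhibits a zero
    -- column.
    have : 1 < Nat.card {p // scaledColumn h p = 0} := by rw [hcard]; norm_num
    have : Nontrivial {p // scaledColumn h p = 0} := by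
      rw [← Finite.one_lt_card_iff_nontrivial]
      exact this
    obtain ⟨⟨p, hp⟩, hne⟩ := exists_ne (⟨none, rfl⟩ : {p // scaledColumn h p = 0})
    rcases p with _ | ⟨k, a⟩
    · exact absurd rfl hne
    · exact ⟨k, (smul_eq_zero_iff_right a.ne_zero).1 hp⟩
  obtain ⟨z, hz⟩ := hzero
  let e : ∀ i, Fin 3 ≃ {p // scaledColumn h p = h' i} := fun i =>
    (Finite.equivFinOfCardEq (hcard _)).symm
  have hsome : ∀ i j, ∃ q : Fin n × (ZMod 3)ˣ, (e i j).1 = some q := by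
    intro i j
    rw [← Option.ne_none_iff_exists']
    intro hnone
    have := (e i j).2
    rw [hnone] at this
    exact h'_ne i this.symm
  choose q hq using hsome
  have hcol : ∀ i j, ((q i j).2 : ZMod 3) • h (q i j).1 = h' i := by
    intro i j
    have := (e i j).2
    rwa [hq] at this
  refine ⟨fun o => o.elim z fun p => (q p.1 p.2).1, fun o => o.elim 1 fun p => (q p.1 p.2).2,
    ?_, hz, hcol⟩
  rintro (_ | ⟨i, j⟩) (_ | ⟨i', j'⟩) hij <;> simp only [Option.elim] at hij
  · rfl
  · exact absurd (by rw [← hcol i' j', ← hij, hz, smul_zero]) (h'_ne i')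
  · exact absurd (by rw [← hcol i j, hij, hz, smul_zero]) (h'_ne i)
  -- A position used twice makes `h' i` and `h' i'` proportional. Injectivity forces `i = i'` and
  -- equal scalars, so both come from the same one of the three representations.
  · have hscaled : (((q i' j').2 * (q i j).2⁻¹ : (ZMod 3)ˣ) : ZMod 3) • h' i = h' i' := by
      rw [← hcol i j, ← hcol i' j', hij, ← mul_smul, ← Units.val_mul, inv_mul_cancel_right]
    have hp := @hinj (some (i, (q i' j').2 * (q i j).2⁻¹)) (some (i', 1))
      (by rw [scaledColumn_some, scaledColumn_some, hscaled, Units.val_one, one_smul])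
    simp only [Option.some.injEq, Prod.mk.injEq] at hp
    obtain ⟨rfl, h2⟩ := hp
    have hqq : q i j = q i j' := Prod.ext hij (mul_inv_eq_one.1 h2).symm
    obtain rfl : j = j' := (e i).injective (Subtype.ext (by rw [hq, hq, hqq]))
    rfl

end Syndromes

/-! ### Monomial automorphisms. -/

section Monomial

variable {n : ℕ}

/-- The automorphism of the Hamming graph that translates by `-c`, permutes the positions by `σ`,
and multiplies the symbols by the nonzero scalars `a`. -/
def monomialIso (c : Word n) (σ : Fin n ≃ Fin n) (a : Fin n → (ZMod 3)ˣ) :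
    hammingGraph3 n ≃g hammingGraph3 n where
  toFun x k := a k * (x (σ k) - c (σ k))
  invFun y k := ↑(a (σ.symm k))⁻¹ * y (σ.symm k) + c k
  left_inv x := by
    funext k
    simp only [Units.inv_mul_cancel_left, Equiv.apply_symm_apply, sub_add_cancel]
  right_inv y := by
    funext k
    simp only [Equiv.symm_apply_apply, add_sub_cancel_right, Units.mul_inv_cancel_left]
  map_rel_iff' {x y} := by
    have : hammingDist (fun k => (a k : ZMod 3) * (x (σ k) - c (σ k)))
        (fun k => (a k : ZMod 3) * (y (σ k) - c (σ k))) = hammingDist x y := by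
      unfold hammingDist
      exact Finset.card_equiv σ (by simp)
    change hammingDist _ _ = 1 ↔ hammingDist _ _ = 1
    rw [← this]
    rfl

theorem monomialIso_apply (c : Word n) (σ : Fin n ≃ Fin n) (a : Fin n → (ZMod 3)ˣ) (x : Word n)
    (k : Fin n) : monomialIso c σ a x k = a k * (x (σ k) - c (σ k)) := rfl

end Monomial

/-! ### Reduction to block sums, and the theorem. -/

theorem LinearMap.exists_surjective_of_finrank_le {K V W : Type*} [Field K] [AddCommGroup V]
    [Module K V] [AddCommGroup W] [Module K W] [Module.Finite K V] [Module.Finite K W]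
    (h : Module.finrank K W ≤ Module.finrank K V) : ∃ f : V →ₗ[K] W, Function.Surjective f := by
  obtain ⟨g, hg⟩ := finrank_le_iff_exists_linearMap.1 h
  obtain ⟨f, hf⟩ := g.exists_leftInverse_of_injective (LinearMap.ker_eq_bot.2 hg)
  exact ⟨f, fun w => ⟨g w, LinearMap.congr_fun hf w⟩⟩

theorem linearMap_eq_sum_smul {n : ℕ} {Q : Type*} [AddCommGroup Q] [Module (ZMod 3) Q]
    (S : Word n →ₗ[ZMod 3] Q) (x : Word n) : S x = ∑ k, x k • S (Pi.single k 1) := by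
  conv_lhs => rw [← Finset.univ_sum_single x, map_sum]
  refine Finset.sum_congr rfl fun k _ => ?_
  rw [← map_smul, ← Pi.single_smul, smul_eq_mul, mul_one]

/-- A perfect code on which a linear map onto the syndrome space of a Hamming code is constant is
equivalent to a perfect code whose block sums lie in the Hamming code. -/
theorem exists_iso_blockSum_mem {n t : ℕ} (h : n = 3 * t + 1) {C : Set (Word n)}
    (hC : IsOnePerfect (hammingGraph3 n) C) {H : Submodule (ZMod 3) (Word t)}
    (hH : IsHammingCode H) {S : Word n →ₗ[ZMod 3] Word t ⧸ H} (hS : Function.Surjective S)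
    {c : Word n} (hSC : ∀ x ∈ C, S x = S c) :
    ∃ ψ : hammingGraph3 n ≃g hammingGraph3 n, ∀ x ∈ C, blockSum h (ψ x) ∈ H := by
  have hcard : ∀ s, Nat.card {p // scaledColumn (fun k => S (Pi.single k 1)) p = s} = 3 := by
    intro s
    have := hC.card_fiber_mul_card hS hSC s
    rw [hH.card_quotient] at this
    -- `2n + 1 = 3(2t + 1)`, since `n = 3t + 1`.
    exact Nat.eq_of_mul_eq_mul_right (Nat.succ_pos (2 * t)) (this.trans (by omega))
  obtain ⟨g, a, hg, hlast, htriple⟩ := exists_columns_eq_smul hcard hH.scaledColumn_mkQ_injective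
  let γ := Equiv.ofBijective g (bijective_of_injective_option h hg)
  -- The inverse scalars cancel those that carry the columns of `S` to the Hamming columns;
  -- translating by `-c` makes the constant syndrome zero.
  let ψ := monomialIso c ((blockEquiv h).symm.trans γ) fun k => (a ((blockEquiv h).symm k))⁻¹
  have hψ : ∀ x i j, ψ x (tripleCoord h i j) =
      ↑(a (some (i, j)))⁻¹ * (x - c) (g (some (i, j))) := by
    intro x i j
    simp only [ψ, monomialIso_apply, Equiv.trans_apply, blockEquiv_symm_triple]
    rfl
  refine ⟨ψ, fun x hx => ?_⟩
  rw [← Submodule.Quotient.mk_eq_zero, ← Submodule.mkQ_apply, linearMap_eq_sum_smul]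
  have hzero : S (x - c) = 0 := by rw [map_sub, hSC x hx, sub_self]
  rw [← hzero, linearMap_eq_sum_smul, ← γ.sum_comp, Fintype.sum_option]
  change _ = (x - c) (g none) • S (Pi.single (g none) 1) +
    ∑ p, (x - c) (g (some p)) • S (Pi.single (g (some p)) 1)
  rw [hlast, smul_zero, zero_add, Fintype.sum_prod_type]
  refine Finset.sum_congr rfl fun i _ => ?_
  rw [blockSum, Finset.sum_smul]
  refine Finset.sum_congr rfl fun j _ => ?_
  rw [hψ, ← htriple i j, smul_smul, mul_right_comm, Units.inv_mul, one_mul]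

theorem theorem3p1 (m : ℕ) (hm : 1 ≤ m)
    (C : Set (Word ((3 ^ m - 1) / 2)))
    (hC : IsOnePerfect (hammingGraph3 ((3 ^ m - 1) / 2)) C)
    (hrank : codeRank C ≤ ((3 ^ m - 1) / 2 - m) + 1)
    (Cstar : Submodule (ZMod 3) (Word ((3 ^ (m - 1) - 1) / 2)))
    (hCstar : IsHammingCode Cstar) :
    ∃ (ψ : hammingGraph3 ((3 ^ m - 1) / 2) ≃g hammingGraph3 ((3 ^ m - 1) / 2))
      (lam : Cstar → Word ((3 ^ (m - 1) - 1) / 2) → ZMod 3),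
      (∀ μ : Cstar, IsQuasigroup3 (lam μ)) ∧
      ψ '' C = ⋃ μ : Cstar, muComponent (length_eq_three_mul_add_one hm) μ.1 (lam μ) := by
  set D := (affineSpan (ZMod 3) C).direction
  have hfin : Module.finrank (ZMod 3) (Word ((3 ^ (m - 1) - 1) / 2) ⧸ Cstar) = m - 1 := by
    have hcard := hCstar.card_quotient
    rw [Module.natCard_eq_pow_finrank (K := ZMod 3), Nat.card_zmod] at hcard
    refine Nat.pow_right_injective (by norm_num : 2 ≤ 3) (hcard.trans ?_)
    have hodd : Odd (3 ^ (m - 1)) := Odd.pow (by decide)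
    change _ = 3 ^ (m - 1)
    obtain ⟨r, hr⟩ := hodd
    omega
  -- Ensures that the subtraction `n - m` in the rank bound is not truncated.
  have hle : m ≤ (3 ^ m - 1) / 2 := by
    have : 2 * m + 1 ≤ 3 ^ m := by
      clear * -
      induction m with
      | zero => simp
      | succ k ih => rw [pow_succ]; omega
    omega
  have hquot : Module.finrank (ZMod 3) (Word ((3 ^ (m - 1) - 1) / 2) ⧸ Cstar) ≤
      Module.finrank (ZMod 3) (Word ((3 ^ m - 1) / 2) ⧸ D) := by
    have hsum : Module.finrank (ZMod 3) (Word ((3 ^ m - 1) / 2) ⧸ D) +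
        Module.finrank (ZMod 3) D = (3 ^ m - 1) / 2 :=
      D.finrank_quotient_add_finrank.trans (Module.finrank_fin_fun _)
    have hr : Module.finrank (ZMod 3) D ≤ ((3 ^ m - 1) / 2 - m) + 1 := hrank
    omega
  obtain ⟨f, hf⟩ := LinearMap.exists_surjective_of_finrank_le hquot
  obtain ⟨c, hc⟩ := hC.nonempty
  obtain ⟨ψ, hψ⟩ := exists_iso_blockSum_mem (length_eq_three_mul_add_one hm) hC hCstar
    (S := f ∘ₗ D.mkQ) (hf.comp D.mkQ_surjective) (c := c) fun x hx => by
      rw [LinearMap.comp_apply, LinearMap.comp_apply, ← sub_eq_zero, ← map_sub, ← map_sub]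
      have : x - c ∈ D := AffineSubspace.vsub_mem_direction (mem_affineSpan _ hx)
        (mem_affineSpan _ hc)
      rw [(D.mkQ_apply _).trans ((Submodule.Quotient.mk_eq_zero D).2 this), map_zero]
  obtain ⟨lam, hlam, heq⟩ := exists_eq_iUnion_muComponent (length_eq_three_mul_add_one hm)
    (hC.image ψ) hCstar (by rintro _ ⟨x, hx, rfl⟩; exact hψ x hx)
  exact ⟨ψ, lam, hlam, heq⟩
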